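/- **Lemma ($\lambda$-cone condition).** Let $n\ge 1$, and let $Q$ be the space of real symmetric $n\times n$ matrices with the inner product $a\cdot b=\operatorname{tr}(ab)$. For a real number $\lambda\ge 1$ let $$K_\lambda=\{a\in Q:\ \text{there is } C>0 \text{ such that all eigenvalues of } a \text{ lie in } [C/\lambda,\,C\lambda]\},$$ $$L_\lambda=\{a\in Q:\ a\cdot b=0\ \text{ for some } b\in K_\lambda\}.$$ Let $\Sigma\subset Q$ be a compact $C^\infty$ embedded submanifold without boundary, of dimension $n-1$, such that $a-b\in L_\lambda$ for all $a,b\in\Sigma$ (the $\lambda$-cone condition). Then there exist a $C^\infty$ function $F:Q\to\mathbb R$ with $F=0$ on $\Sigma$ and a constant $\Lambda$ with $1\le \Lambda<4\lambda^2\sqrt n$ such that $F$ is uniformly elliptic with ellipticity constant $\Lambda$, i.e. $$\Lambda^{-1}|\xi|^2\ \le\ \sum_{i,j}F_{u_{ij}}(A)\,\xi_i\xi_j\ \le\ \Lambda|\xi|^2\qquad\text{for all } A\in Q,\ \xi\in\mathbb R^n,$$ where $\sum_{i,j}F_{u_{ij}}(A)\xi_i\xi_j$ denotes the derivative of $F$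 at $A$ in the direction of the rank-one matrix $\xi\xi^{T}=(\xi_i\xi_j)$. -/

import Mathlib

open scoped Matrix ContDiff

attribute [local instance] Matrix.frobeniusNormedAddCommGroup Matrix.frobeniusNormedSpace

/-- The space `Q` of real symmetric `n × n` matrices, with the norm of the inner product
`a · b = trace (a b)` (the Frobenius norm). -/
abbrev SymMat (n : ℕ) : Submodule ℝ (Matrix (Fin n) (Fin n) ℝ) where
  carrier := {A | A.IsSymm}
  add_mem' := fun hA hB => hA.add hB
  zero_mem' := Matrix.isSymm_zero
  smul_mem' := fun c _ hA => hA.smul c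

namespace SymMat

variable {n : ℕ}

/-- The inner product `a · b = trace (a b)`. -/
def dot (a b : SymMat n) : ℝ := ((a : Matrix (Fin n) (Fin n) ℝ) * (b : Matrix (Fin n) (Fin n) ℝ)).trace

/-- The rank one symmetric matrix `ξ ξᵀ = (ξᵢ ξⱼ)`. -/
def rankOne (ξ : Fin n → ℝ) : SymMat n :=
  ⟨Matrix.vecMulVec ξ ξ, Matrix.transpose_vecMulVec ξ ξ⟩

/-- The cone `K_λ` : all eigenvalues lie in `[C/λ, Cλ]` for some `C > 0`. -/
def coneK (n : ℕ) (lam : ℝ) : Set (SymMat n) :=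
  {a | ∃ C : ℝ, 0 < C ∧ spectrum ℝ (a : Matrix (Fin n) (Fin n) ℝ) ⊆ Set.Icc (C / lam) (C * lam)}

/-- The adjoint cone `K_λ* = {b : b · c ≥ 0 for all c ∈ K_λ}`. -/
def adjointConeK (n : ℕ) (lam : ℝ) : Set (SymMat n) :=
  {b | ∀ c ∈ coneK n lam, 0 ≤ dot b c}

/-- `L_λ` : the union of all hyperplanes of `Q` through the origin with normal in `K_λ`.
It contains `Q ∖ (K_λ* ∪ -K_λ*)`, see `mem_coneL_of_notMem_adjointConeK`. -/
def coneL (n : ℕ) (lam : ℝ) : Set (SymMat n) :=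
  {a | ∃ b ∈ coneK n lam, dot a b = 0}

/-- `K_λ` in terms of the semidefinite order. -/
theorem mem_coneK_iff {lam : ℝ} {a : SymMat n} :
    a ∈ coneK n lam ↔ ∃ C : ℝ, 0 < C ∧
      ((a : Matrix (Fin n) (Fin n) ℝ) - algebraMap ℝ _ (C / lam)).PosSemidef ∧
      (algebraMap ℝ _ (C * lam) - (a : Matrix (Fin n) (Fin n) ℝ)).PosSemidef := by
  have ha : (a : Matrix (Fin n) (Fin n) ℝ).IsHermitian := by
    have := a.2
    rwa [Matrix.IsHermitian, Matrix.conjTranspose_eq_transpose_of_trivial]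
  have hr : ∀ r : ℝ, (algebraMap ℝ (Matrix (Fin n) (Fin n) ℝ) r).IsHermitian := by
    intro r
    rw [Matrix.IsHermitian, Matrix.conjTranspose_eq_transpose_of_trivial,
      Matrix.algebraMap_eq_diagonal, Matrix.diagonal_transpose]
  refine exists_congr fun C => and_congr_right fun _ => ?_
  rw [Matrix.posSemidef_iff_isHermitian_and_spectrum_nonneg,
    Matrix.posSemidef_iff_isHermitian_and_spectrum_nonneg,
    ← spectrum.sub_singleton_eq, ← spectrum.singleton_sub_eq]
  simp only [ha.sub (hr _), (hr _).sub ha, true_and, Set.sub_singleton, Set.singleton_sub,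
    Set.image_subset_iff]
  constructor
  · intro h
    exact ⟨fun x hx => by simpa using (h hx).1, fun x hx => by simpa using (h hx).2⟩
  · rintro ⟨h1, h2⟩ x hx
    exact ⟨by simpa using h1 hx, by simpa using h2 hx⟩

/-- `K_λ` is closed under positive combinations. -/
theorem smul_add_smul_mem_coneK {lam s t : ℝ} (hs : 0 < s) (ht : 0 < t) {a b : SymMat n}
    (ha : a ∈ coneK n lam) (hb : b ∈ coneK n lam) : s • a + t • b ∈ coneK n lam := by
  rw [mem_coneK_iff] at *
  obtain ⟨C, hC, h1, h2⟩ := ha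
  obtain ⟨D, hD, h3, h4⟩ := hb
  refine ⟨s * C + t * D, by positivity, ?_, ?_⟩
  · convert (h1.smul hs.le).add (h3.smul ht.le) using 1
    simp only [Submodule.coe_add, Submodule.coe_smul, Algebra.algebraMap_eq_smul_one]
    module
  · convert (h2.smul hs.le).add (h4.smul ht.le) using 1
    simp only [Submodule.coe_add, Submodule.coe_smul, Algebra.algebraMap_eq_smul_one]
    module

/-- A matrix that lies neither in `K_λ*` nor in `-K_λ*` is orthogonal to a matrix of `K_λ`. -/
theorem mem_coneL_of_notMem_adjointConeK {lam : ℝ} {a : SymMat n}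
    (h1 : a ∉ adjointConeK n lam) (h2 : -a ∉ adjointConeK n lam) : a ∈ coneL n lam := by
  simp only [adjointConeK, Set.mem_ofPred_eq, not_forall, not_le] at h1 h2
  obtain ⟨c, hc, hac⟩ := h1
  obtain ⟨d, hd, had⟩ := h2
  have had' : 0 < dot a d := by
    have : dot (-a) d = -dot a d := by simp [dot]
    linarith
  refine ⟨dot a d • c + (-dot a c) • d,
    smul_add_smul_mem_coneK had' (by linarith) hc hd, ?_⟩
  have : dot a (dot a d • c + (-dot a c) • d) = dot a d * dot a c + (-dot a c) * dot a d := by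
    simp [dot, Matrix.mul_add, Matrix.trace_add]
  rw [this]
  ring

/-- The `λ`-cone condition: all differences of points of `G` lie in `L_λ`. -/
def ConeCondition (lam : ℝ) (G : Set (SymMat n)) : Prop :=
  ∀ a ∈ G, ∀ b ∈ G, a - b ∈ coneL n lam

/-- Uniform ellipticity with constant `Λ ≥ 1`:
`Λ⁻¹ |ξ|² ≤ ∑ F_{ij} ξᵢ ξⱼ ≤ Λ |ξ|²` at every symmetric matrix and for every `ξ`. The sum is
the derivative of `F` in the direction `ξ ξᵀ`; the differentiability of `F` is part of the
definition. -/
def IsUniformlyElliptic (F : SymMat n → ℝ) (Lam : ℝ) : Prop :=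
  1 ≤ Lam ∧ Differentiable ℝ F ∧ ∀ (A : SymMat n) (ξ : Fin n → ℝ),
    Lam⁻¹ * ∑ i, ξ i ^ 2 ≤ fderiv ℝ F A (rankOne ξ) ∧
      fderiv ℝ F A (rankOne ξ) ≤ Lam * ∑ i, ξ i ^ 2

end SymMat

/-- `S` is an embedded smooth (`C^∞`) submanifold of dimension `m`, without boundary, of the
normed space `E`: near each of its points a smooth diffeomorphism `Φ` between open subsets of `E`
carries `S` to an `m`-dimensional linear subspace `V`. -/
def IsSmoothSubmanifold {E : Type*} [NormedAddCommGroup E] [NormedSpace ℝ E]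
    (m : ℕ) (S : Set E) : Prop :=
  ∀ p ∈ S, ∃ (Φ : OpenPartialHomeomorph E E) (V : Submodule ℝ E),
    p ∈ Φ.source ∧ ContDiffOn ℝ ∞ Φ Φ.source ∧ ContDiffOn ℝ ∞ Φ.symm Φ.target ∧
      Module.finrank ℝ V = m ∧ ∀ x ∈ Φ.source, x ∈ S ↔ Φ x ∈ V

open Filter Topology Metric Set MeasureTheory
open scoped Convolution

/-! Let `p = pucci lam` be the support function of the matrices of `K_λ` normalized by `C = 1`. If
`dF ≤ p + ε‖·‖`, evaluation at `±ξξᵀ`, whose norm is `|ξ|²`, bounds `dF(ξξᵀ)` between `(λ⁻¹ -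
ε)|ξ|²` and `(λ + ε)|ξ|²`. With `ε = 1/(2λ)` this gives the constant `2λ`. The cone condition yields
`0 ≤ p (a - b)` on `Σ`, so the zero function on `Σ` has increments dominated by the sublinear
function `p`. It remains to extend it smoothly, losing only `ε`.

A McShane extension followed by mollification keeps the domination but no longer vanishes on `Σ`. So
a smooth `G` is first built near `Σ`. Passing to limits of difference quotients, `p ≥ 0` on tangent
spaces, and Hahn–Banach gives functionals below `p` that vanish there; composed with charts and
glued, they give `G` (`IsSmoothSubmanifold.exists_defining`). On a thin neighbourhood the increments
of `G` are dominated by `p` up to a small multiple of the norm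
(`IsBoundedSublinear.exists_increment_le`). Hence `G` itself has a McShane extension; its
mollification `f` is uniformly close to `G` there, and `ψ G + (1 - ψ) f` with a cutoff `ψ` is the
required function. -/

theorem HasFDerivAt.tendsto_slope_right {E F : Type*} [NormedAddCommGroup E] [NormedSpace ℝ E]
    [NormedAddCommGroup F] [NormedSpace ℝ F] {f : E → F} {f' : E →L[ℝ] F} {x : E}
    (hf : HasFDerivAt f f' x) (v : E) :
    Tendsto (fun t : ℝ => t⁻¹ • (f (x + t • v) - f x)) (𝓝[>] 0) (𝓝 (f' v)) := by
  have h : HasDerivAt (fun t : ℝ => f (x + t • v)) (f' v) 0 := hf.hasLineDerivAt v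
  simpa using h.tendsto_slope_zero_right

/-- A sublinear function `p` on a normed space with the bound `p v ≤ M ‖v‖`. -/
structure IsBoundedSublinear {E : Type*} [NormedAddCommGroup E] [NormedSpace ℝ E]
    (p : E → ℝ) (M : ℝ) : Prop where
  map_smul : ∀ c : ℝ, 0 < c → ∀ v, p (c • v) = c * p v
  map_add_le : ∀ u v, p (u + v) ≤ p u + p v
  le_norm : ∀ v, p v ≤ M * ‖v‖

/-! ### Functions with increments dominated by a sublinear function -/

namespace IsBoundedSublinear

variable {E : Type*} [NormedAddCommGroup E] [NormedSpace ℝ E] {p : E → ℝ} {M : ℝ}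

theorem map_zero (hp : IsBoundedSublinear p M) : p 0 = 0 := by
  have := hp.map_smul 2 two_pos 0
  rw [smul_zero] at this
  linarith

theorem add_norm (hp : IsBoundedSublinear p M) {ε : ℝ} (hε : 0 ≤ ε) :
    IsBoundedSublinear (fun v => p v + ε * ‖v‖) (M + ε) where
  map_smul c hc v := by
    simp only [hp.map_smul c hc, norm_smul, Real.norm_of_nonneg hc.le]
    ring
  map_add_le u v := by
    have h1 := hp.map_add_le u v
    have h2 := mul_le_mul_of_nonneg_left (norm_add_le u v) hε
    linarith
  le_norm v := by
    have := hp.le_norm v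
    linarith

theorem comp_continuousLinearMap {F : Type*} [NormedAddCommGroup F] [NormedSpace ℝ F]
    (hp : IsBoundedSublinear p M) (hM : 0 ≤ M) (B : F →L[ℝ] E) :
    IsBoundedSublinear (fun v => p (B v)) (M * ‖B‖) where
  map_smul c hc v := by simp [hp.map_smul c hc]
  map_add_le u v := by simpa using hp.map_add_le (B u) (B v)
  le_norm v := (hp.le_norm _).trans <| by
    rw [mul_assoc]
    exact mul_le_mul_of_nonneg_left (B.le_opNorm v) hM

/-- A function whose increments are dominated by a sublinear function is Lipschitz. -/
theorem lipschitzWith (hp : IsBoundedSublinear p M) {f : E → ℝ}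
    (hf : ∀ x v, f (x + v) ≤ f x + p v) : LipschitzWith M.toNNReal f := by
  refine LipschitzWith.of_le_add_mul' _ fun x y => ?_
  have h1 := hf y (x - y)
  have h2 := hp.le_norm (x - y)
  rw [add_sub_cancel] at h1
  rw [dist_eq_norm]
  linarith

theorem continuous (hp : IsBoundedSublinear p M) : Continuous p :=
  (hp.lipschitzWith hp.map_add_le).continuous

/-- Domination of increments passes to the derivative. -/
theorem fderiv_le (hp : IsBoundedSublinear p M) {f : E → ℝ} {x : E}
    (hd : DifferentiableAt ℝ f x) (hf : ∀ᶠ y in 𝓝 x, f y ≤ f x + p (y - x)) (v : E) :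
    fderiv ℝ f x v ≤ p v := by
  have h1 := hd.hasFDerivAt.tendsto_slope_right v
  have h2 : Tendsto (fun t : ℝ => x + t • v) (𝓝[>] 0) (𝓝 x) := by
    have : Continuous fun t : ℝ => x + t • v := by fun_prop
    simpa using (this.tendsto 0).mono_left nhdsWithin_le_nhds
  refine le_of_tendsto h1 ?_
  filter_upwards [h2.eventually hf, self_mem_nhdsWithin] with t ht (ht0 : 0 < t)
  rw [add_sub_cancel_left, hp.map_smul t ht0] at ht
  rw [smul_eq_mul, inv_mul_le_iff₀ ht0]
  linarith

/-- McShane extension: a function on `W` whose increments are dominated by a sublinear function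
extends to the whole space with the same property. -/
theorem exists_extension (hp : IsBoundedSublinear p M) {W : Set E} (hW : W.Nonempty) {G : E → ℝ}
    (hG : ∀ a ∈ W, ∀ b ∈ W, G a - G b ≤ p (a - b)) :
    ∃ H : E → ℝ, (∀ a ∈ W, H a = G a) ∧ ∀ x v, H (x + v) ≤ H x + p v := by
  have : Nonempty W := hW.to_subtype
  have hbdd : ∀ x, BddBelow (range fun b : W => G b + p (x - b)) := by
    intro x
    obtain ⟨b₀, hb₀⟩ := hW
    refine ⟨G b₀ - p (b₀ - x), ?_⟩
    rintro _ ⟨⟨b, hb⟩, rfl⟩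
    have h1 := hG b₀ hb₀ b hb
    have h2 := hp.map_add_le (b₀ - x) (x - b)
    rw [sub_add_sub_cancel] at h2
    simp only
    linarith
  -- This infimum is the largest extension that the domination allows.
  refine ⟨fun x => ⨅ b : W, G b + p (x - b), fun a ha => le_antisymm ?_ ?_, fun x v => ?_⟩
  · refine (ciInf_le (hbdd a) ⟨a, ha⟩).trans ?_
    simp [hp.map_zero]
  · refine le_ciInf fun b => ?_
    have := hG a ha b b.2
    linarith
  · rw [← sub_le_iff_le_add]
    refine le_ciInf fun b => ?_
    have h1 := ciInf_le (hbdd (x + v)) b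
    have h2 := hp.map_add_le (x - b) v
    rw [sub_add_eq_add_sub] at h2
    linarith

/-- Mollification: a function whose increments are dominated by a sublinear function is a uniform
limit of smooth functions with the same property. -/
theorem exists_contDiff_approx [FiniteDimensional ℝ E] (hp : IsBoundedSublinear p M) (hM : 0 ≤ M)
    {H : E → ℝ} (hH : ∀ x v, H (x + v) ≤ H x + p v) {η : ℝ} (hη : 0 < η) :
    ∃ f : E → ℝ, ContDiff ℝ ∞ f ∧ (∀ x, |f x - H x| ≤ η) ∧ ∀ x v, f (x + v) ≤ f x + p v := by
  borelize E
  let μ : Measure E := Measure.addHaar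
  have hlip := hp.lipschitzWith hH
  have hcont := hlip.continuous
  -- `M + 1` instead of the Lipschitz constant `M`, which may vanish.
  have hr : 0 < η / (M + 1) := by positivity
  let φ : ContDiffBump (0 : E) := ⟨η / (M + 1) / 2, η / (M + 1), by positivity, by linarith⟩
  have hconv := (φ.hasCompactSupport_normed (μ := μ)).convolutionExists_left (μ := μ)
    (ContinuousLinearMap.lsmul ℝ ℝ) φ.continuous_normed (hcont.locallyIntegrable (μ := μ))
  refine ⟨φ.normed μ ⋆[ContinuousLinearMap.lsmul ℝ ℝ, μ] H, ?_, fun x => ?_, fun x v => ?_⟩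
  · exact (φ.hasCompactSupport_normed (μ := μ)).contDiff_convolution_left _ φ.contDiff_normed
      hcont.locallyIntegrable
  · rw [← Real.dist_eq]
    refine ContDiffBump.dist_normed_convolution_le hcont.aestronglyMeasurable fun y hy => ?_
    refine (hlip.dist_le_mul y x).trans ?_
    rw [Real.coe_toNNReal M hM]
    have hy' : dist y x < η / (M + 1) := hy
    calc M * dist y x ≤ (M + 1) * (η / (M + 1)) := by gcongr; linarith
      _ = η := by field_simp
  -- The kernel has mass one, so `p v` is its own average, and the inequality for `H` at `x - t` can
  -- be averaged over `t`.
  · have hint : Integrable (fun t => φ.normed μ t * p v) μ :=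
      (φ.integrable_normed (μ := μ)).mul_const _
    have h1 : ∫ t, φ.normed μ t * p v ∂μ = p v := by
      rw [integral_mul_const, φ.integral_normed (μ := μ), one_mul]
    rw [← h1, convolution_def, convolution_def, ← integral_add (hconv x).integrable hint]
    refine integral_mono (hconv (x + v)).integrable ((hconv x).integrable.add hint) fun t => ?_
    have h2 := mul_le_mul_of_nonneg_left (hH (x - t) v) (φ.nonneg_normed (μ := μ) t)
    rw [sub_add_eq_add_sub] at h2
    simpa [mul_add] using h2

end IsBoundedSublinear

/-- The product of a smooth function with a function that is smooth near its support. -/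
theorem ContDiff.mul_of_tsupport_subset {E : Type*} [NormedAddCommGroup E] [NormedSpace ℝ E]
    {f g : E → ℝ} {U : Set E} {k : ℕ∞} (hf : ContDiff ℝ k f) (hU : IsOpen U)
    (hg : ContDiffOn ℝ k g U) (hfU : tsupport f ⊆ U) : ContDiff ℝ k (fun x => f x * g x) := by
  rw [contDiff_iff_contDiffAt]
  intro x
  by_cases hx : x ∈ tsupport f
  · exact hf.contDiffAt.mul (hg.contDiffAt (hU.mem_nhds (hfU hx)))
  · have h0 : (fun _ => (0 : ℝ)) =ᶠ[𝓝 x] fun x => f x * g x := by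
      filter_upwards [notMem_tsupport_iff_eventuallyEq.mp hx] with y hy
      simp [hy]
    exact contDiffAt_const.congr_of_eventuallyEq h0.symm

/-! ### Defining functions near a submanifold -/

section Submanifold

variable {E : Type*} [NormedAddCommGroup E] [NormedSpace ℝ E] [FiniteDimensional ℝ E]
  {p : E → ℝ} {M : ℝ} {S : Set E} {m : ℕ}

/-- A sublinear function that is nonnegative on the differences of points of a submanifold
dominates the differential of a local defining function. -/
theorem IsSmoothSubmanifold.exists_local_defining (hS : IsSmoothSubmanifold m S)
    (hp : IsBoundedSublinear p M) (hM : 0 ≤ M) (hpS : ∀ a ∈ S, ∀ b ∈ S, 0 ≤ p (a - b))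
    {ε : ℝ} (hε : 0 < ε) {x₀ : E} (hx₀ : x₀ ∈ S) :
    ∃ (U : Set E) (g : E → ℝ), IsOpen U ∧ x₀ ∈ U ∧ ContDiffOn ℝ ∞ g U ∧
      (∀ x ∈ U ∩ S, g x = 0) ∧ ∀ x ∈ U, ∀ v, fderiv ℝ g x v ≤ p v + ε * ‖v‖ := by
  obtain ⟨Φ, V, hsrc, hΦ, hΨ, -, hSV⟩ := hS x₀ hx₀
  have hy₀ := Φ.map_source hsrc
  have hΦd : DifferentiableAt ℝ Φ x₀ :=
    (hΦ.contDiffAt (Φ.open_source.mem_nhds hsrc)).differentiableAt (by simp)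
  have hΨd : DifferentiableAt ℝ Φ.symm (Φ x₀) :=
    (hΨ.contDiffAt (Φ.open_target.mem_nhds hy₀)).differentiableAt (by simp)
  set A := fderiv ℝ Φ x₀
  set B := fderiv ℝ Φ.symm (Φ x₀)
  have hBA : ∀ v, B (A v) = v := by
    have h1 : HasFDerivAt (Φ.symm ∘ Φ) (B.comp A) x₀ :=
      hΨd.hasFDerivAt.comp x₀ hΦd.hasFDerivAt
    have h2 : HasFDerivAt (Φ.symm ∘ Φ) (ContinuousLinearMap.id ℝ E) x₀ :=
      (hasFDerivAt_id x₀).congr_of_eventuallyEq (Φ.eventually_left_inverse hsrc)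
    intro v
    exact DFunLike.congr_fun (h1.unique h2) v
  -- `B u` is a tangent vector: the limit of difference quotients of the curve `Φ.symm (Φ x₀ + t •
  -- u)` in `S`. Positive homogeneity and continuity of `p` preserve the sign.
  have hV : ∀ u ∈ V, 0 ≤ p (B u) := by
    intro u hu
    have h1 := hΨd.hasFDerivAt.tendsto_slope_right u
    have h2 : Tendsto (fun t : ℝ => Φ x₀ + t • u) (𝓝[>] 0) (𝓝 (Φ x₀)) := by
      have : Continuous fun t : ℝ => Φ x₀ + t • u := by fun_prop
      simpa using (this.tendsto 0).mono_left nhdsWithin_le_nhds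
    refine ge_of_tendsto (((hp.continuous).tendsto _).comp h1) ?_
    filter_upwards [h2.eventually (Φ.open_target.mem_nhds hy₀), self_mem_nhdsWithin]
      with t ht (ht0 : 0 < t)
    have hmem : Φ.symm (Φ x₀ + t • u) ∈ S := by
      rw [hSV _ (Φ.map_target ht), Φ.right_inv ht]
      exact V.add_mem ((hSV _ hsrc).mp hx₀) (V.smul_mem _ hu)
    simp only [Function.comp, Φ.left_inv hsrc]
    rw [hp.map_smul _ (inv_pos.mpr ht0)]
    exact mul_nonneg (inv_pos.mpr ht0).le (hpS _ hmem _ hx₀)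
  have hpB := hp.comp_continuousLinearMap hM B
  -- Hahn–Banach, starting from the zero functional on `V`. The pullback by `Φ` vanishes on `S`, and
  -- its differential `ℓ ∘ A` at `x₀` is below `p` because `B ∘ A = id`.
  obtain ⟨ℓ, hℓV, hℓ⟩ := exists_extension_of_le_sublinear (⟨V, 0⟩ : E →ₗ.[ℝ] ℝ)
    (fun v => p (B v)) hpB.map_smul hpB.map_add_le (fun u => hV u u.2)
  let L : E →L[ℝ] ℝ := LinearMap.toContinuousLinearMap ℓ
  have hg : ContDiffOn ℝ ∞ (fun x => L (Φ x)) Φ.source := L.contDiff.comp_contDiffOn hΦ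
  have hgd : fderiv ℝ (fun x => L (Φ x)) x₀ = L.comp A :=
    (L.hasFDerivAt.comp x₀ hΦd.hasFDerivAt).fderiv
  have hdc : ContinuousOn (fderiv ℝ (fun x => L (Φ x))) Φ.source :=
    hg.continuousOn_fderiv_of_isOpen Φ.open_source (by simp)
  refine ⟨Φ.source ∩ fderiv ℝ (fun x => L (Φ x)) ⁻¹' ball (L.comp A) ε, fun x => L (Φ x),
    hdc.isOpen_inter_preimage Φ.open_source isOpen_ball, ⟨hsrc, by simp [hgd, hε]⟩,
    hg.mono inter_subset_left, ?_, ?_⟩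
  · rintro x ⟨⟨hx, -⟩, hxS⟩
    exact hℓV ⟨Φ x, (hSV x hx).mp hxS⟩
  · rintro x ⟨-, hx⟩ v
    have h1 : L (A v) ≤ p v := (hℓ (A v)).trans_eq (by simp [hBA])
    have h2 := (le_abs_self _).trans
      ((fderiv ℝ (fun x => L (Φ x)) x - L.comp A).le_of_opNorm_le (mem_ball_iff_norm.mp hx).le v)
    simp only [_root_.sub_apply, ContinuousLinearMap.comp_apply] at h2
    linarith

/-- Local defining functions glue to a defining function on a neighbourhood. -/
theorem IsSmoothSubmanifold.exists_defining (hS : IsSmoothSubmanifold m S) (hSc : IsCompact S)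
    (hp : IsBoundedSublinear p M) (hM : 0 ≤ M) (hpS : ∀ a ∈ S, ∀ b ∈ S, 0 ≤ p (a - b))
    {ε : ℝ} (hε : 0 < ε) :
    ∃ (U : Set E) (G : E → ℝ), IsOpen U ∧ S ⊆ U ∧ ContDiffOn ℝ ∞ G U ∧
      (∀ x ∈ S, G x = 0) ∧ ∀ x ∈ S, ∀ v, fderiv ℝ G x v ≤ p v + ε * ‖v‖ := by
  have key : ∃ f g : E → ℝ, ContDiff ℝ ∞ f ∧ ContDiff ℝ ∞ g ∧ (∀ x, 0 ≤ f x) ∧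
      (∀ x ∈ S, 0 < f x) ∧ (∀ x ∈ S, g x = 0) ∧
      ∀ x ∈ S, ∀ v, fderiv ℝ g x v ≤ f x * (p v + ε * ‖v‖) := by
    -- The pair `(f, g)` records a sum of bumps and the corresponding weighted sum of local defining
    -- functions. The condition is additive in the pair; the final quotient `g / f` normalizes the
    -- weights.
    refine hSc.induction_on (p := fun s => ∃ f g : E → ℝ, ContDiff ℝ ∞ f ∧ ContDiff ℝ ∞ g ∧
      (∀ x, 0 ≤ f x) ∧ (∀ x ∈ s, 0 < f x) ∧ (∀ x ∈ S, g x = 0) ∧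
      ∀ x ∈ S, ∀ v, fderiv ℝ g x v ≤ f x * (p v + ε * ‖v‖)) ?_ ?_ ?_ ?_
    · exact ⟨fun _ => 0, fun _ => 0, contDiff_const, contDiff_const, by simp, by simp, by simp,
        by simp⟩
    · rintro s t hst ⟨f, g, hf, hg, hf0, hfs, h⟩
      exact ⟨f, g, hf, hg, hf0, fun x hx => hfs x (hst hx), h⟩
    · rintro s t ⟨f, g, hf, hg, hf0, hfs, hgS, hd⟩ ⟨f', g', hf', hg', hf0', hfs', hgS', hd'⟩
      refine ⟨fun x => f x + f' x, fun x => g x + g' x, hf.add hf', hg.add hg',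
        fun x => add_nonneg (hf0 x) (hf0' x), ?_, fun x hx => by simp [hgS x hx, hgS' x hx], ?_⟩
      · rintro x (hx | hx)
        · exact add_pos_of_pos_of_nonneg (hfs x hx) (hf0' x)
        · exact add_pos_of_nonneg_of_pos (hf0 x) (hfs' x hx)
      · intro x hx v
        rw [fderiv_fun_add (hg.differentiable (by simp) x) (hg'.differentiable (by simp) x),
          add_mul]
        exact add_le_add (hd x hx v) (hd' x hx v)
    · intro x₀ hx₀
      obtain ⟨U, g, hU, hxU, hg, hg0, hgd⟩ := hS.exists_local_defining hp hM hpS hε hx₀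
      obtain ⟨f, hfU, -, hf, hf01, hf1⟩ :=
        exists_contDiff_tsupport_subset (n := ⊤) (hU.mem_nhds hxU)
      refine ⟨{x | 0 < f x}, mem_nhdsWithin_of_mem_nhds
        ((isOpen_lt continuous_const hf.continuous).mem_nhds (by simp [hf1])), f,
        fun x => f x * g x, hf, hf.mul_of_tsupport_subset hU hg hfU,
        fun x => (hf01 (mem_range_self x)).1, fun x hx => hx, fun x hx => ?_, fun x hx v => ?_⟩
      · by_cases h : x ∈ U
        · simp [hg0 x ⟨h, hx⟩]
        · simp [image_eq_zero_of_notMem_tsupport fun h' => h (hfU h')]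
      · by_cases h : x ∈ tsupport f
        · have hgx := (hg.contDiffAt (hU.mem_nhds (hfU h))).differentiableAt (by simp)
          -- As `g = 0` on `S`, the term with the derivative of the weight drops out; the same
          -- happens for the quotient below.
          rw [fderiv_fun_mul (hf.differentiable (by simp) x) hgx, hg0 x ⟨hfU h, hx⟩]
          simpa using mul_le_mul_of_nonneg_left (hgd x (hfU h) v) (hf01 (mem_range_self x)).1
        · have h0 : (fun x => f x * g x) =ᶠ[𝓝 x] fun _ => 0 := by
            filter_upwards [notMem_tsupport_iff_eventuallyEq.mp h] with y hy
            simp [hy]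
          simp [h0.fderiv_eq, image_eq_zero_of_notMem_tsupport h]
  obtain ⟨f, g, hf, hg, -, hfS, hgS, hd⟩ := key
  refine ⟨{x | 0 < f x}, fun x => (f x)⁻¹ * g x, isOpen_lt continuous_const hf.continuous, hfS,
    (hf.contDiffOn.inv fun x hx => (ne_of_gt hx)).mul hg.contDiffOn, fun x hx => by simp [hgS x hx],
    fun x hx v => ?_⟩
  have hfx := hfS x hx
  rw [fderiv_fun_mul ((hf.differentiable (by simp) x).fun_inv hfx.ne')
    (hg.differentiable (by simp) x), hgS x hx]
  simpa [inv_mul_le_iff₀ hfx] using hd x hx v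

end Submanifold

/-! ### Increments near the submanifold and the global extension -/

section Submanifold

variable {E : Type*} [NormedAddCommGroup E] [NormedSpace ℝ E]
  {p : E → ℝ} {M : ℝ} {S : Set E} {m : ℕ}

/-- If a function vanishes on a compact set `S`, the differences of whose points satisfy
`0 ≤ p (a - b)`, and if its differential is dominated by `p + ε ‖·‖` on `S`, then its increments
near `S` are dominated by `p + 2 ε ‖·‖`. -/
theorem IsBoundedSublinear.exists_increment_le (hp : IsBoundedSublinear p M) (hM : 0 ≤ M)
    (hSc : IsCompact S) (hpS : ∀ a ∈ S, ∀ b ∈ S, 0 ≤ p (a - b)) {U : Set E} (hU : IsOpen U)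
    (hSU : S ⊆ U) {G : E → ℝ} (hG : ContDiffOn ℝ ∞ G U) (hG0 : ∀ x ∈ S, G x = 0) {ε : ℝ}
    (hε : 0 < ε) (hGd : ∀ x ∈ S, ∀ v, fderiv ℝ G x v ≤ p v + ε * ‖v‖) :
    ∃ δ > 0, thickening δ S ⊆ U ∧ ∀ a ∈ thickening δ S, ∀ b ∈ thickening δ S,
      G a - G b ≤ p (a - b) + 2 * ε * ‖a - b‖ := by
  have hdc : ContinuousOn (fderiv ℝ G) U := hG.continuousOn_fderiv_of_isOpen hU (by simp)
  have hO : IsOpen (U ∩ fderiv ℝ G ⁻¹' ⋃ y ∈ S, ball (fderiv ℝ G y) ε) :=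
    hdc.isOpen_inter_preimage hU (isOpen_biUnion fun _ _ => isOpen_ball)
  obtain ⟨r, hr, hrO⟩ := hSc.exists_thickening_subset_open hO
    fun x hx => ⟨hSU hx, mem_biUnion hx (mem_ball_self hε)⟩
  have hd : ∀ x ∈ thickening r S, ∀ v, fderiv ℝ G x v ≤ p v + 2 * ε * ‖v‖ := by
    intro x hx v
    obtain ⟨y, hy, hxy⟩ := mem_iUnion₂.mp (hrO hx).2
    have h1 := hGd y hy v
    have h2 := (le_abs_self _).trans
      ((fderiv ℝ G x - fderiv ℝ G y).le_of_opNorm_le (mem_ball_iff_norm.mp hxy).le v)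
    rw [_root_.sub_apply] at h2
    linarith
  have hmvt : ∀ (c : E) (s : ℝ), ball c s ⊆ thickening r S → ∀ a ∈ ball c s, ∀ b ∈ ball c s,
      G a - G b ≤ p (a - b) + 2 * ε * ‖a - b‖ := by
    intro c s hs a ha b hb
    have hf : ∀ x ∈ ball c s, HasFDerivWithinAt G (fderiv ℝ G x) (ball c s) x := fun x hx =>
      ((hG.contDiffAt (hU.mem_nhds (hrO (hs hx)).1)).differentiableAt
        (by simp)).hasFDerivAt.hasFDerivWithinAt
    obtain ⟨z, hz, h⟩ := domain_mvt hf (convex_ball c s) hb ha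
    rw [h]
    exact hd z (hs ((convex_ball c s).segment_subset hb ha hz)) _
  have hq := hp.add_norm (by positivity : 0 ≤ 2 * ε)
  -- The first bound keeps the `r / 2`-ball around a point of the `δ`-thickening inside the
  -- `r`-thickening. The second serves pairs at distance at least `r / 2`: moving both points to `S`
  -- costs at most `2 δ (2 M + 2 ε) ≤ ε r`, which the slack `2 ε ‖a - b‖` absorbs.
  have hδ : 0 < min (r / 2) (ε * (r / 2) / (2 * M + 2 * ε)) := by positivity
  refine ⟨_, hδ, fun x hx => (hrO (thickening_mono ?_ S hx)).1, fun a ha b hb => ?_⟩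
  · exact (min_le_left _ _).trans (by linarith)
  set δ := min (r / 2) (ε * (r / 2) / (2 * M + 2 * ε)) with hδ_def
  have hδr : δ ≤ r / 2 := min_le_left _ _
  have hδM : δ * (2 * M + 2 * ε) ≤ ε * (r / 2) :=
    (le_div_iff₀ (by positivity)).mp (min_le_right _ _)
  obtain ⟨a₀, ha₀, haa⟩ := mem_thickening_iff.mp ha
  obtain ⟨b₀, hb₀, hbb⟩ := mem_thickening_iff.mp hb
  by_cases hab : dist b a < r / 2
  · refine hmvt a (r / 2) (fun x hx => mem_thickening_iff.mpr ⟨a₀, ha₀, ?_⟩) a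
      (mem_ball_self (by positivity)) b hab
    have := dist_triangle x a a₀
    rw [mem_ball] at hx
    linarith
  · have hab' : r / 2 ≤ ‖a - b‖ := by rwa [not_lt, dist_comm, dist_eq_norm] at hab
    have hball : ∀ c ∈ S, ball c r ⊆ thickening r S := fun c hc x hx =>
      mem_thickening_iff.mpr ⟨c, hc, hx⟩
    have h1 := hmvt a₀ r (hball a₀ ha₀) a (by rw [mem_ball]; linarith) a₀ (mem_ball_self hr)
    have h2 := hmvt b₀ r (hball b₀ hb₀) b₀ (mem_ball_self hr) b (by rw [mem_ball]; linarith)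
    have h3 := hp.map_add_le (a - b) (a₀ - a + (b - b₀))
    have h4 := hp.map_add_le (a₀ - a) (b - b₀)
    rw [show a - b + (a₀ - a + (b - b₀)) = a₀ - b₀ by abel] at h3
    have h5 := hpS a₀ ha₀ b₀ hb₀
    have h6 := hq.le_norm (a - a₀)
    have h7 := hq.le_norm (b₀ - b)
    have h8 := hp.le_norm (a₀ - a)
    have h9 := hp.le_norm (b - b₀)
    rw [hG0 _ ha₀] at h1
    rw [hG0 _ hb₀] at h2
    rw [dist_eq_norm] at haa hbb
    rw [norm_sub_rev] at h8
    rw [norm_sub_rev b₀ b] at h7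
    simp only [norm_sub_rev b₀ b] at h2 h7
    have h10 : (2 * M + 2 * ε) * ‖a - a₀‖ ≤ (2 * M + 2 * ε) * δ := by gcongr
    have h11 : (2 * M + 2 * ε) * ‖b - b₀‖ ≤ (2 * M + 2 * ε) * δ := by gcongr
    have h12 : ε * (r / 2) ≤ ε * ‖a - b‖ := by gcongr
    linarith

/-- A smooth cutoff function of a neighbourhood of a compact set. -/
theorem IsCompact.exists_contDiff_cutoff [FiniteDimensional ℝ E] (hSc : IsCompact S) {δ : ℝ}
    (hδ : 0 < δ) :
    ∃ ψ : E → ℝ, ContDiff ℝ ∞ ψ ∧ HasCompactSupport ψ ∧ tsupport ψ ⊆ thickening δ S ∧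
      (∀ x, ψ x ∈ Icc (0 : ℝ) 1) ∧ ∀ x ∈ S, ψ x = 1 := by
  have : ProperSpace E := FiniteDimensional.proper_real E
  obtain ⟨ψ, hψ, hψr, hsupp, hψ1⟩ := exists_contMDiff_support_eq_eq_one_iff (n := ⊤)
    -- Half the radius, so that the closed support stays in the open `δ`-thickening.
    (modelWithCornersSelf ℝ E) (isOpen_thickening (δ := δ / 2) (E := S)) hSc.isClosed
    (self_subset_thickening (half_pos hδ) S)
  have hts : tsupport ψ ⊆ cthickening (δ / 2) S := by
    rw [tsupport, hsupp]
    exact closure_thickening_subset_cthickening _ _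
  exact ⟨ψ, hψ.contDiff, hSc.cthickening.of_isClosed_subset (isClosed_tsupport ψ) hts,
    hts.trans (cthickening_subset_thickening' hδ (half_lt_self hδ) S),
    fun x => hψr (mem_range_self x), fun x hx => (hψ1 x).mp hx⟩

/-- A compact submanifold, the differences of whose points satisfy `0 ≤ p (a - b)`, lies in the
zero set of a smooth function whose differential is dominated by `p + ε ‖·‖`. -/
theorem IsSmoothSubmanifold.exists_contDiff_fderiv_le [FiniteDimensional ℝ E]
    (hS : IsSmoothSubmanifold m S) (hSc : IsCompact S) (hSne : S.Nonempty)
    (hp : IsBoundedSublinear p M) (hM : 0 ≤ M)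
    (hpS : ∀ a ∈ S, ∀ b ∈ S, 0 ≤ p (a - b)) {ε : ℝ} (hε : 0 < ε) :
    ∃ F : E → ℝ, ContDiff ℝ ∞ F ∧ (∀ a ∈ S, F a = 0) ∧
      ∀ x v, fderiv ℝ F x v ≤ p v + ε * ‖v‖ := by
  -- With `ε / 4` the increments of `G` have slack `ε / 2`; the other half pays for differentiating
  -- the cutoff.
  obtain ⟨U, G, hU, hSU, hG, hG0, hGd⟩ :=
    hS.exists_defining hSc hp hM hpS (by positivity : 0 < ε / 4)
  obtain ⟨δ, hδ, hδU, hGinc⟩ :=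
    hp.exists_increment_le hM hSc hpS hU hSU hG hG0 (by positivity : 0 < ε / 4) hGd
  have hq := hp.add_norm (by positivity : 0 ≤ 2 * (ε / 4))
  have hqM : 0 ≤ M + 2 * (ε / 4) := by positivity
  obtain ⟨H, hHG, hH⟩ := hq.exists_extension (hSne.mono (self_subset_thickening hδ S)) hGinc
  obtain ⟨ψ, hψ, hψc, hψS, hψ01, hψ1⟩ := hSc.exists_contDiff_cutoff hδ
  obtain ⟨C, hC⟩ := (hψ.continuous_fderiv (by simp)).bounded_above_of_compact_support
    (hψc.fderiv ℝ)
  have hC0 : 0 ≤ C := (norm_nonneg _).trans (hC 0)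
  obtain ⟨f, hf, hfH, hfinc⟩ :=
    hq.exists_contDiff_approx hqM hH (by positivity : 0 < ε / 2 / (C + 1))
  have hfd : ∀ x v, fderiv ℝ f x v ≤ p v + 2 * (ε / 4) * ‖v‖ := fun x =>
    hq.fderiv_le (hf.differentiable (by simp) x)
      (Eventually.of_forall fun y => by simpa using hfinc x (y - x))
  refine ⟨fun x => ψ x * G x + (1 - ψ x) * f x,
    (hψ.mul_of_tsupport_subset hU hG (hψS.trans hδU)).add ((contDiff_const.sub hψ).mul hf),
    fun a ha => by simp [hψ1 a ha, hG0 a ha], fun x v => ?_⟩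
  have hεv : 0 ≤ ε * ‖v‖ := by positivity
  by_cases hx : x ∈ tsupport ψ
  · have hxδ := hψS hx
    have hψx := hψ.differentiable (by simp) x
    have hfx := hf.differentiable (by simp) x
    have hGx : DifferentiableAt ℝ G x :=
      (hG.contDiffAt (hU.mem_nhds (hδU hxδ))).differentiableAt (by simp)
    have hGv : fderiv ℝ G x v ≤ p v + 2 * (ε / 4) * ‖v‖ := by
      refine hq.fderiv_le hGx ?_ v
      filter_upwards [isOpen_thickening.mem_nhds hxδ] with y hy
      linarith [hGinc y hy x hxδ]
    have hfG : |G x - f x| ≤ ε / 2 / (C + 1) := by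
      rw [← hHG x hxδ, abs_sub_comm]
      exact hfH x
    -- The only term of the derivative that is not a convex combination of `dG` and `df`; the
    -- mollification tolerance was chosen against the bound `C` on `dψ`.
    have hψv : (G x - f x) * fderiv ℝ ψ x v ≤ ε / 2 * ‖v‖ :=
      calc (G x - f x) * fderiv ℝ ψ x v ≤ |G x - f x| * |fderiv ℝ ψ x v| := by
            rw [← abs_mul]
            exact le_abs_self _
        _ ≤ ε / 2 / (C + 1) * ((C + 1) * ‖v‖) := by
            gcongr
            refine (fderiv ℝ ψ x).le_of_opNorm_le ((hC x).trans ?_) v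
            linarith
        _ = ε / 2 * ‖v‖ := by field_simp
    rw [fderiv_fun_add (hψx.fun_mul hGx) ((hψx.const_sub 1).fun_mul hfx), fderiv_fun_mul hψx hGx,
      fderiv_fun_mul (hψx.const_sub 1) hfx, fderiv_const_sub]
    simp only [_root_.add_apply, _root_.smul_apply, _root_.neg_apply, smul_eq_mul]
    have h1 := mul_le_mul_of_nonneg_left hGv (hψ01 x).1
    have h2 := mul_le_mul_of_nonneg_left (hfd x v) (sub_nonneg.mpr (hψ01 x).2)
    linarith
  · have h0 : (fun x => ψ x * G x + (1 - ψ x) * f x) =ᶠ[𝓝 x] f := by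
      filter_upwards [notMem_tsupport_iff_eventuallyEq.mp hx] with y hy
      simp [hy]
    rw [h0.fderiv_eq]
    linarith [hfd x v]

end Submanifold

/-! ### The Pucci operator and ellipticity -/

namespace SymMat

variable {n : ℕ}

theorem frobenius_norm_sq (A : Matrix (Fin n) (Fin n) ℝ) : ‖A‖ ^ 2 = ∑ i, ∑ j, A i j ^ 2 := by
  rw [Matrix.frobenius_norm_def, ← Real.sqrt_eq_rpow, Real.sq_sqrt (by positivity)]
  simp

theorem norm_rankOne (ξ : Fin n → ℝ) : ‖rankOne ξ‖ = ∑ i, ξ i ^ 2 := by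
  have h : 0 ≤ ∑ i, ξ i ^ 2 := Finset.sum_nonneg fun i _ => sq_nonneg _
  rw [← sq_eq_sq₀ (norm_nonneg _) h, Submodule.coe_norm, frobenius_norm_sq, sq (∑ i, ξ i ^ 2),
    Finset.sum_mul_sum]
  simp [rankOne, Matrix.vecMulVec_apply, mul_pow]

theorem dot_add_left (a b c : SymMat n) : dot (a + b) c = dot a c + dot b c := by
  simp [dot, Matrix.add_mul]

theorem dot_smul_left (t : ℝ) (a c : SymMat n) : dot (t • a) c = t * dot a c := by
  simp [dot]

theorem dot_smul_right (t : ℝ) (a c : SymMat n) : dot a (t • c) = t * dot a c := by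
  simp [dot]

theorem dot_neg_left (a c : SymMat n) : dot (-a) c = -dot a c := by
  simp [dot]

theorem dot_rankOne (ξ : Fin n → ℝ) (b : SymMat n) :
    dot (rankOne ξ) b = ξ ⬝ᵥ ((b : Matrix (Fin n) (Fin n) ℝ) *ᵥ ξ) := by
  rw [dot, rankOne, Matrix.vecMulVec_mul, Matrix.trace_vecMulVec, Matrix.dotProduct_mulVec,
    dotProduct_comm]

/-- The matrices of `K_λ` normalized by `C = 1`. -/
def normalizedConeK (n : ℕ) (lam : ℝ) : Set (SymMat n) :=
  {b | ∀ ξ : Fin n → ℝ, lam⁻¹ * ∑ i, ξ i ^ 2 ≤ dot (rankOne ξ) b ∧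
    dot (rankOne ξ) b ≤ lam * ∑ i, ξ i ^ 2}

theorem dot_rankOne_one (ξ : Fin n → ℝ) :
    dot (rankOne ξ) ⟨1, Matrix.isSymm_one⟩ = ∑ i, ξ i ^ 2 := by
  simp [dot_rankOne, dotProduct, sq]

theorem one_mem_normalizedConeK {lam : ℝ} (hlam : 1 ≤ lam) :
    (⟨1, Matrix.isSymm_one⟩ : SymMat n) ∈ normalizedConeK n lam := by
  intro ξ
  have h : 0 ≤ ∑ i, ξ i ^ 2 := Finset.sum_nonneg fun i _ => sq_nonneg _
  rw [dot_rankOne_one]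
  exact ⟨mul_le_of_le_one_left h (inv_le_one_of_one_le₀ hlam), le_mul_of_one_le_left h hlam⟩

theorem exists_smul_mem_normalizedConeK {lam : ℝ} {b : SymMat n} (hb : b ∈ coneK n lam) :
    ∃ t : ℝ, t • b ∈ normalizedConeK n lam := by
  obtain ⟨C, hC, h1, h2⟩ := mem_coneK_iff.mp hb
  refine ⟨C⁻¹, fun ξ => ?_⟩
  have h3 := h1.dotProduct_mulVec_nonneg ξ
  have h4 := h2.dotProduct_mulVec_nonneg ξ
  have h5 : ξ ⬝ᵥ ξ = ∑ i, ξ i ^ 2 := by simp [dotProduct, sq]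
  simp only [star_trivial, Matrix.sub_mulVec, dotProduct_sub, Algebra.algebraMap_eq_smul_one,
    Matrix.smul_mulVec, Matrix.one_mulVec, dotProduct_smul, smul_eq_mul, sub_nonneg,
    ← dot_rankOne, h5] at h3 h4
  rw [dot_smul_right, le_inv_mul_iff₀ hC, inv_mul_le_iff₀ hC]
  constructor
  · rw [← mul_assoc]
    exact h3
  · rw [← mul_assoc]
    exact h4

/-- Polarization: the quadratic form at `eᵢ + eⱼ` and `eᵢ - eⱼ` lies in `[0, 4λ]`, and the two
values differ by `4 bᵢⱼ`. The bound makes the supremum in `pucci` finite. -/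
theorem abs_apply_le_of_mem_normalizedConeK {lam : ℝ} (hlam : 0 ≤ lam) {b : SymMat n}
    (hb : b ∈ normalizedConeK n lam) (i j : Fin n) :
    |(b : Matrix (Fin n) (Fin n) ℝ) i j| ≤ lam := by
  have hs : (b : Matrix (Fin n) (Fin n) ℝ) j i = (b : Matrix (Fin n) (Fin n) ℝ) i j := b.2.apply i j
  have hq : ∀ s : ℝ, dot (rankOne (Pi.single i 1 + s • Pi.single j 1)) b =
      (b : Matrix (Fin n) (Fin n) ℝ) i i + 2 * s * (b : Matrix (Fin n) (Fin n) ℝ) i j +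
        s ^ 2 * (b : Matrix (Fin n) (Fin n) ℝ) j j := by
    intro s
    simp [dot_rankOne, Matrix.mulVec_add, Matrix.mulVec_smul, hs]
    ring
  have hn : ∀ s : ℝ, |s| ≤ 1 →
      ∑ k, (Pi.single i 1 + s • Pi.single j 1 : Fin n → ℝ) k ^ 2 ≤ 4 := by
    intro s hs
    calc ∑ k, (Pi.single i 1 + s • Pi.single j 1 : Fin n → ℝ) k ^ 2
        -- Crude for `i ≠ j`, but it also covers `i = j`, where the value `4` is attained.
        ≤ ∑ k, ((Pi.single i 2 : Fin n → ℝ) k + (Pi.single j 2 : Fin n → ℝ) k) := by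
          refine Finset.sum_le_sum fun k _ => ?_
          obtain ⟨h1, h2⟩ := abs_le.mp hs
          simp only [Pi.add_apply, Pi.smul_apply, Pi.single_apply, smul_eq_mul]
          split_ifs <;> nlinarith
      _ = 4 := by
          rw [Finset.sum_add_distrib]
          norm_num
  have hnn : ∀ ξ : Fin n → ℝ, 0 ≤ ∑ k, ξ k ^ 2 := fun ξ =>
    Finset.sum_nonneg fun i _ => sq_nonneg _
  have hinv : 0 ≤ lam⁻¹ := inv_nonneg.mpr hlam
  have hbd : ∀ s : ℝ, |s| ≤ 1 → 0 ≤ dot (rankOne (Pi.single i 1 + s • Pi.single j 1)) b ∧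
      dot (rankOne (Pi.single i 1 + s • Pi.single j 1)) b ≤ lam * 4 := fun s hs =>
    ⟨(mul_nonneg hinv (hnn _)).trans (hb _).1,
      (hb _).2.trans (mul_le_mul_of_nonneg_left (hn s hs) hlam)⟩
  obtain ⟨h1, h2⟩ := hbd 1 (by simp)
  obtain ⟨h3, h4⟩ := hbd (-1) (by simp)
  rw [hq] at h1 h2 h3 h4
  rw [abs_le]
  constructor <;> linarith

theorem dot_le_of_mem_normalizedConeK {lam : ℝ} (hlam : 0 ≤ lam) {b : SymMat n}
    (hb : b ∈ normalizedConeK n lam) (v : SymMat n) : dot v b ≤ n * n * lam * ‖v‖ := by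
  have hv : ∀ i j, |(v : Matrix (Fin n) (Fin n) ℝ) i j| ≤ ‖v‖ := by
    intro i j
    rw [← abs_norm v, ← sq_le_sq, Submodule.coe_norm, frobenius_norm_sq]
    have h1 := Finset.single_le_sum (f := fun j => (v : Matrix (Fin n) (Fin n) ℝ) i j ^ 2)
      (fun j _ => sq_nonneg _) (Finset.mem_univ j)
    exact h1.trans (Finset.single_le_sum
      (f := fun i => ∑ j, (v : Matrix (Fin n) (Fin n) ℝ) i j ^ 2)
      (fun i _ => Finset.sum_nonneg fun j _ => sq_nonneg _) (Finset.mem_univ i))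
  have h : ∀ i j, (v : Matrix (Fin n) (Fin n) ℝ) i j * (b : Matrix (Fin n) (Fin n) ℝ) j i ≤
      ‖v‖ * lam := by
    intro i j
    refine (le_abs_self _).trans ?_
    rw [abs_mul]
    exact mul_le_mul (hv i j) (abs_apply_le_of_mem_normalizedConeK hlam hb j i) (abs_nonneg _)
      (norm_nonneg _)
  calc dot v b = ∑ i, ∑ j, (v : Matrix (Fin n) (Fin n) ℝ) i j *
        (b : Matrix (Fin n) (Fin n) ℝ) j i := by simp [dot, Matrix.trace, Matrix.mul_apply]
    _ ≤ ∑ _i : Fin n, ∑ _j : Fin n, ‖v‖ * lam :=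
        Finset.sum_le_sum fun i _ => Finset.sum_le_sum fun j _ => h i j
    _ = n * n * lam * ‖v‖ := by
        simp only [Finset.sum_const, Finset.card_univ, Fintype.card_fin, nsmul_eq_mul]
        ring

/-- The support function of the normalized cone (a Pucci maximal operator). -/
noncomputable def pucci (lam : ℝ) (v : SymMat n) : ℝ :=
  ⨆ b : normalizedConeK n lam, dot v b

theorem dot_le_pucci {lam : ℝ} (hlam : 0 ≤ lam) {b : SymMat n} (hb : b ∈ normalizedConeK n lam)
    (v : SymMat n) : dot v b ≤ pucci lam v :=
  le_ciSup (f := fun b : normalizedConeK n lam => dot v b)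
    ⟨n * n * lam * ‖v‖, by
      rintro _ ⟨c, rfl⟩
      exact dot_le_of_mem_normalizedConeK hlam c.2 v⟩ ⟨b, hb⟩

theorem pucci_le {lam : ℝ} (hlam : 1 ≤ lam) {v : SymMat n} {t : ℝ}
    (h : ∀ b ∈ normalizedConeK n lam, dot v b ≤ t) : pucci lam v ≤ t := by
  have : Nonempty (normalizedConeK n lam) := ⟨⟨_, one_mem_normalizedConeK hlam⟩⟩
  exact ciSup_le fun b => h b b.2

theorem isBoundedSublinear_pucci {lam : ℝ} (hlam : 1 ≤ lam) :
    IsBoundedSublinear (pucci lam : SymMat n → ℝ) (n * n * lam) where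
  map_smul c hc v := by
    simp only [pucci, dot_smul_left]
    exact (Real.mul_iSup_of_nonneg hc.le _).symm
  map_add_le u v := pucci_le hlam fun b hb => by
    rw [dot_add_left]
    exact add_le_add (dot_le_pucci (by linarith) hb u) (dot_le_pucci (by linarith) hb v)
  le_norm v := pucci_le hlam fun b hb => dot_le_of_mem_normalizedConeK (by linarith) hb v

/-- A normal in `K_λ` orthogonal to `a`, once rescaled, competes in the supremum with value zero.
This is where the cone condition enters. -/
theorem pucci_nonneg_of_mem_coneL {lam : ℝ} (hlam : 0 ≤ lam) {a : SymMat n}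
    (ha : a ∈ coneL n lam) : 0 ≤ pucci lam a := by
  obtain ⟨b, hb, hab⟩ := ha
  obtain ⟨t, ht⟩ := exists_smul_mem_normalizedConeK hb
  refine le_trans ?_ (dot_le_pucci hlam ht a)
  rw [dot_smul_right, hab, mul_zero]

theorem pucci_rankOne_le {lam : ℝ} (hlam : 1 ≤ lam) (ξ : Fin n → ℝ) :
    pucci lam (rankOne ξ) ≤ lam * ∑ i, ξ i ^ 2 :=
  pucci_le hlam fun _ hb => (hb ξ).2

theorem pucci_neg_rankOne_le {lam : ℝ} (hlam : 1 ≤ lam) (ξ : Fin n → ℝ) :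
    pucci lam (-rankOne ξ) ≤ -(lam⁻¹ * ∑ i, ξ i ^ 2) :=
  pucci_le hlam fun b hb => by
    rw [dot_neg_left]
    exact neg_le_neg (hb ξ).1

/-- A function whose differential is dominated by `pucci lam + (2 lam)⁻¹ ‖·‖` is uniformly
elliptic. -/
theorem isUniformlyElliptic_of_fderiv_le {lam : ℝ} (hlam : 1 ≤ lam) {F : SymMat n → ℝ}
    (hF : Differentiable ℝ F) (hd : ∀ A v, fderiv ℝ F A v ≤ pucci lam v + (2 * lam)⁻¹ * ‖v‖) :
    IsUniformlyElliptic F (2 * lam) := by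
  refine ⟨by linarith, hF, fun A ξ => ?_⟩
  have h0 : 0 ≤ ∑ i, ξ i ^ 2 := Finset.sum_nonneg fun i _ => sq_nonneg _
  have h1 := hd A (rankOne ξ)
  have h2 := hd A (-rankOne ξ)
  rw [map_neg, norm_neg] at h2
  rw [norm_rankOne] at h1 h2
  have h3 := pucci_rankOne_le hlam ξ
  have h4 := pucci_neg_rankOne_le hlam ξ
  -- The slack uses up half of the lower bound `λ⁻¹`, and at most doubles the upper bound `λ`.
  have h5 : lam⁻¹ = 2 * (2 * lam)⁻¹ := by field_simp
  have h6 : (2 * lam)⁻¹ * ∑ i, ξ i ^ 2 ≤ lam * ∑ i, ξ i ^ 2 := by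
    gcongr
    exact (inv_le_one_of_one_le₀ (by linarith)).trans hlam
  rw [h5] at h4
  constructor <;> linarith

/-- There is a smooth uniformly elliptic function, namely the trace. -/
theorem exists_isUniformlyElliptic {lam : ℝ} (hlam : 1 ≤ lam) :
    ∃ F : SymMat n → ℝ, ContDiff ℝ ∞ F ∧ IsUniformlyElliptic F (2 * lam) := by
  let ℓ : SymMat n →ₗ[ℝ] ℝ :=
    { toFun := fun a => dot a ⟨1, Matrix.isSymm_one⟩
      map_add' := fun a b => dot_add_left a b _
      map_smul' := fun t a => dot_smul_left t a _ }
  let L : SymMat n →L[ℝ] ℝ := LinearMap.toContinuousLinearMap ℓ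
  refine ⟨L, L.contDiff, isUniformlyElliptic_of_fderiv_le hlam L.differentiable fun A v => ?_⟩
  rw [L.fderiv]
  have h1 : L v ≤ pucci lam v := dot_le_pucci (by linarith) (one_mem_normalizedConeK hlam) v
  have h2 : 0 ≤ (2 * lam)⁻¹ * ‖v‖ := by positivity
  linarith

end SymMat

theorem mainTheorem4 (n : ℕ) (hn : 1 ≤ n) (lam : ℝ) (hlam : 1 ≤ lam)
    (S : Set (SymMat n)) (hS : IsCompact S) (hS_sub : IsSmoothSubmanifold (n - 1) S)
    (hS_cone : SymMat.ConeCondition lam S) :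
    ∃ F : SymMat n → ℝ, ContDiff ℝ ∞ F ∧ (∀ a ∈ S, F a = 0) ∧
      ∃ Lam : ℝ, Lam < 4 * lam ^ 2 * Real.sqrt n ∧ SymMat.IsUniformlyElliptic F Lam := by
  have hLam : 2 * lam < 4 * lam ^ 2 * Real.sqrt n := by
    have h1 : 1 ≤ Real.sqrt n := Real.one_le_sqrt.mpr (by exact_mod_cast hn)
    have h2 : 4 * lam ^ 2 ≤ 4 * lam ^ 2 * Real.sqrt n := le_mul_of_one_le_right (by positivity) h1
    nlinarith
  have hlam0 : 0 < lam := by linarith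
  -- The McShane infimum needs a nonempty set.
  rcases S.eq_empty_or_nonempty with rfl | hne
  · obtain ⟨F, hF, hell⟩ := SymMat.exists_isUniformlyElliptic (n := n) hlam
    exact ⟨F, hF, by simp, 2 * lam, hLam, hell⟩
  obtain ⟨F, hF, hF0, hd⟩ := hS_sub.exists_contDiff_fderiv_le hS hne
    (SymMat.isBoundedSublinear_pucci hlam) (by positivity)
    (fun a ha b hb => SymMat.pucci_nonneg_of_mem_coneL hlam0.le (hS_cone a ha b hb))
    (by positivity : 0 < (2 * lam)⁻¹)
  exact ⟨F, hF, hF0, 2 * lam, hLam,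
    SymMat.isUniformlyElliptic_of_fderiv_le hlam (hF.differentiable (by simp)) hd⟩
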